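/- Let $\mathbb{G}=(\mathbb{R}^N,\circ)$, $\mathbb{R}^N=\mathbb{R}^{N_1}\times\cdots\times\mathbb{R}^{N_r}$, be a stratified Lie group: a Lie group for which the dilations $\delta_\lambda(x^{(1)},\dots,x^{(r)})=(\lambda x^{(1)},\dots,\lambda^r x^{(r)})$, $\lambda>0$, are automorphisms and whose left-invariant vector fields $X_1,\dots,X_{N_1}$ with $X_j(0)=\partial/\partial x^{(1)}_j$ generate, together with their iterated commutators, the whole tangent space at each point. Let $\nabla_H=(X_1,\dots,X_{N_1})$, and let $S_0^{1,p}(\Omega)$ be the completion of $C_0^\infty(\Omega)$ in the norm $\|f\|_{L^p(\Omega)}+\|\nabla_H f\|_{L^p(\Omega)}$ $(1<p\le\infty)$. Let $\Omega\subset\mathbb{G}$ be a bounded open set and $\mathcal{L}_p u=\nabla_H\cdot(|\nabla_H u|^{p-2}\nabla_H u)$. Consider $$u_t-\mathcal{L}_p u=\alpha\sum_{i=1}^{n}|u|^{q_i-1}u+\gamma\sum_{i=1}^{n}|u|^{s_i-1}u\ \ (x\in\Omega,\ t>0),\qquad u=0\ \ (x\in\partial\Omega,\ t>0),\qquad u(0,\cdot)=u_0,$$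 where $n\ge 1$, $u_0\in S_0^{1,\infty}(\Omega)$, $u_0\ge 0$, $u_0\not\equiv 0$. Put $m=\max\{p,q_i,s_i\}$, $Q_T=(0,T)\times\Omega$. A weak solution on $Q_T$ is a nonnegative function $u\in C([0,T)\times\overline\Omega)\cap L^m((0,T);S_0^{1,m}(\Omega))$ with $\partial_t u\in L^2((0,T);L^2(\Omega))$, $u(0,\cdot)=u_0$, $u=0$ on $(0,T)\times\partial\Omega$, and $$\iint_{Q_T}\Big(\partial_t u\,\varphi+|\nabla_H u|^{p-2}\nabla_H u\cdot\nabla_H\varphi\Big)dx\,dt=\iint_{Q_T}\Big(\alpha\sum_{i=1}^n|u|^{q_i-1}u+\gamma\sum_{i=1}^n|u|^{s_i-1}u\Big)\varphi\,dx\,dt$$ for all $0\le\varphi\in C(\overline{Q_T})\cap L^p((0,T);S_0^{1,p}(\Omega))$ with $\varphi=0$ on $(0,T)\times\partial\Omega$. Assume that one of the following holds: (i) $\alpha>0$, $\gamma<0$, $q_i\ge 1$, $1<p<\min_i s_i+1$ and $q_i<s_i$ for all $i$; (ii) $\alpha<0$, $\gamma>0$, $s_i\ge 1$, $1<p<\min_i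 q_i+1$ and $s_i<q_i$ for all $i$. Then weak solutions are globally bounded in $t$: there is a constant $M$ depending only on $p,n,q_i,s_i,\alpha,\gamma,N_1$, $\Omega$ (as a bounded open subset of $\mathbb{R}^{N_1}\times\cdots\times\mathbb{R}^{N_r}$) and $u_0$ such that for every $T>0$ every weak solution $u$ on $Q_T$ satisfies $0\le u\le M$ on $(0,T)\times\Omega$. -/

import Mathlib

open MeasureTheory Set Filter Topology
open scoped ContDiff Manifold ENNReal

noncomputable section

/-- The space `ℝ^N = ℝ^{N₁} × ⋯ × ℝ^{N_r}` with its Euclidean structure and Lebesgue measure.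
The strata are indexed by `Fin (k + 1)`, so the step is `r = k + 1` and `N 0` is the dimension
`N₁` of the first stratum. -/
abbrev Strata {k : ℕ} (N : Fin (k + 1) → ℕ) : Type :=
  EuclideanSpace ℝ (Σ i : Fin (k + 1), Fin (N i))

namespace Strata

variable {k : ℕ} {N : Fin (k + 1) → ℕ}

/-- The dilation `δ_c (x⁽¹⁾, …, x⁽ʳ⁾) = (c x⁽¹⁾, c² x⁽²⁾, …, cʳ x⁽ʳ⁾)`. -/
def dilation (c : ℝ) (x : Strata N) : Strata N :=
  WithLp.toLp 2 fun i => c ^ ((i.1 : ℕ) + 1) * x i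

/-- The coordinate vector `∂/∂x_j'` of the first stratum. -/
def horizontalBasis (j : Fin (N 0)) : Strata N :=
  EuclideanSpace.single ⟨0, j⟩ 1

end Strata

/-- For a group law on `ℝ^N` with identity `0`, the vector field
`X_j(x) = d(L_x)(0) (∂/∂x_j')`, where `L_x` is the left translation by `x`: the left-invariant
field with `X_j(0) = ∂/∂x_j'`. -/
def leftInvariantField {k : ℕ} {N : Fin (k + 1) → ℕ} [Mul (Strata N)] (j : Fin (N 0))
    (x : Strata N) : Strata N :=
  fderiv ℝ (fun y : Strata N => x * y) 0 (Strata.horizontalBasis j)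

/-- The iterated commutators of a family `X` of vector fields (the members of `X` included). -/
inductive IsIteratedCommutator {E ι : Type} [NormedAddCommGroup E] [NormedSpace ℝ E]
    (X : ι → E → E) : (E → E) → Prop
  | base (j : ι) : IsIteratedCommutator X (X j)
  | bracket {V W : E → E} : IsIteratedCommutator X V → IsIteratedCommutator X W →
      IsIteratedCommutator X (VectorField.lieBracket ℝ V W)

/-- A stratified Lie group structure on `ℝ^N = ℝ^{N₁} × ⋯ × ℝ^{N_r}`: a Lie group law for which
the dilations are automorphisms and the left-invariant fields `X_1, …, X_{N₁}` satisfy the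
Hörmander condition. (The identity is fixed by all dilations, hence it is the origin.) -/
structure StratifiedGroup {k : ℕ} (N : Fin (k + 1) → ℕ) where
  [group : Group (Strata N)]
  dim_pos : ∀ i, 0 < N i
  lieGroup : LieGroup 𝓘(ℝ, Strata N) ∞ (Strata N)
  dilation_mul : ∀ c : ℝ, 0 < c → ∀ x y : Strata N,
    Strata.dilation c (x * y) = Strata.dilation c x * Strata.dilation c y
  hormander : ∀ x : Strata N,
    Submodule.span ℝ
      {v | ∃ V, IsIteratedCommutator (leftInvariantField (N := N)) V ∧ V x = v} = ⊤

namespace StratifiedGroup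

variable {k : ℕ} {N : Fin (k + 1) → ℕ} (G : StratifiedGroup N)

/-- The left-invariant field `X_j` of the first stratum. -/
def X (j : Fin (N 0)) (x : Strata N) : Strata N :=
  letI := G.group
  leftInvariantField j x

/-- The horizontal gradient `∇_H f = (X_1 f, …, X_{N₁} f)` of a differentiable function. -/
def horizontalGradient (f : Strata N → ℝ) (x : Strata N) : EuclideanSpace ℝ (Fin (N 0)) :=
  WithLp.toLp 2 fun j => fderiv ℝ f x (G.X j x)

/-- `f ∈ S₀^{1,p}(Ω)` with horizontal gradient `g`, where `S₀^{1,p}(Ω)` is the completion of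
`C₀^∞(Ω)` in the norm `‖f‖_{L^p(Ω)} + ‖∇_H f‖_{L^p(Ω)}`: the pair `(f, g)` is a limit in `L^p(Ω)`
of pairs `(φ_n, ∇_H φ_n)` with `φ_n ∈ C₀^∞(Ω)`. For `p = ∞` the norms are supremum norms. -/
def HasSobolevGradient (p : ℝ≥0∞) (Ω : Set (Strata N)) (f : Strata N → ℝ)
    (g : Strata N → EuclideanSpace ℝ (Fin (N 0))) : Prop :=
  MemLp f p (volume.restrict Ω) ∧ MemLp g p (volume.restrict Ω) ∧
  ∃ φ : ℕ → Strata N → ℝ,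
    (∀ n, ContDiff ℝ ∞ (φ n) ∧ HasCompactSupport (φ n) ∧ tsupport (φ n) ⊆ Ω) ∧
    Tendsto (fun n => eLpNorm (f - φ n) p (volume.restrict Ω)) atTop (𝓝 0) ∧
    Tendsto (fun n => eLpNorm (g - G.horizontalGradient (φ n)) p (volume.restrict Ω)) atTop (𝓝 0)

/-- `f ∈ S₀^{1,p}(Ω)`. -/
def MemSobolev (p : ℝ≥0∞) (Ω : Set (Strata N)) (f : Strata N → ℝ) : Prop :=
  ∃ g, G.HasSobolevGradient p Ω f g

/-- `u ∈ L^p((0,T); S₀^{1,p}(Ω))`, with horizontal gradient `g`, for `1 ≤ p < ∞`. -/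
def HasParabolicGradient (p : ℝ≥0∞) (T : ℝ) (Ω : Set (Strata N)) (u : ℝ → Strata N → ℝ)
    (g : ℝ → Strata N → EuclideanSpace ℝ (Fin (N 0))) : Prop :=
  MemLp (fun z : ℝ × Strata N => u z.1 z.2) p (volume.restrict (Ioo 0 T ×ˢ Ω)) ∧
  MemLp (fun z : ℝ × Strata N => g z.1 z.2) p (volume.restrict (Ioo 0 T ×ˢ Ω)) ∧
  ∀ᵐ t ∂(volume.restrict (Ioo 0 T)), G.HasSobolevGradient p Ω (u t) (g t)

end StratifiedGroup

/-- `v = ∂_t u` in the sense of distributions on `(0,T) × Ω`, and `v ∈ L²((0,T); L²(Ω))`. -/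
def HasL2TimeDerivative {k : ℕ} {N : Fin (k + 1) → ℕ} (T : ℝ) (Ω : Set (Strata N))
    (u v : ℝ → Strata N → ℝ) : Prop :=
  MemLp (fun z : ℝ × Strata N => v z.1 z.2) 2 (volume.restrict (Ioo 0 T ×ˢ Ω)) ∧
  ∀ ψ : ℝ × Strata N → ℝ, ContDiff ℝ ∞ ψ → HasCompactSupport ψ → tsupport ψ ⊆ Ioo 0 T ×ˢ Ω →
    ∫ z in Ioo 0 T ×ˢ Ω, u z.1 z.2 * fderiv ℝ ψ z (1, 0) =
      -∫ z in Ioo 0 T ×ˢ Ω, v z.1 z.2 * ψ z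

/-- The data of the problem
`u_t - L_p u = α ∑ |u|^{q_i-1} u + γ ∑ |u|^{s_i-1} u` in `(0,T) × Ω`, with `u = 0` on `∂Ω` and
`u(0,·) = u₀`, apart from the group, the domain and the time `T`. -/
structure HeatData {k : ℕ} (N : Fin (k + 1) → ℕ) where
  p : ℝ
  n : ℕ
  q : Fin n → ℝ
  s : Fin n → ℝ
  α : ℝ
  γ : ℝ
  u₀ : Strata N → ℝ

namespace HeatData

variable {k : ℕ} {N : Fin (k + 1) → ℕ} (D : HeatData N)

/-- The right-hand side `α ∑ |y|^{q_i-1} y + γ ∑ |y|^{s_i-1} y`. -/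
def source (y : ℝ) : ℝ :=
  D.α * ∑ i, |y| ^ (D.q i - 1) * y + D.γ * ∑ i, |y| ^ (D.s i - 1) * y

/-- `m = max {p, q_i, s_i}`. -/
def m : ℝ := max D.p (max (⨆ i, D.q i) (⨆ i, D.s i))

/-- Common form of the definitions of weak super- and sub-solutions on `Q_T = (0,T) × Ω`; the
relation `R` is `≥` for super-solutions and `≤` for sub-solutions. -/
def IsWeak (R : ℝ → ℝ → Prop) (G : StratifiedGroup N) (Ω : Set (Strata N)) (T : ℝ)
    (u : ℝ → Strata N → ℝ) : Prop :=
  (∀ t ∈ Ico 0 T, ∀ x ∈ closure Ω, 0 ≤ u t x) ∧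
  ContinuousOn (fun z : ℝ × Strata N => u z.1 z.2) (Ico 0 T ×ˢ closure Ω) ∧
  (∀ᵐ x ∂(volume.restrict Ω), R (u 0 x) (D.u₀ x)) ∧
  (∀ t ∈ Ioo 0 T, ∀ x ∈ frontier Ω, R (u t x) 0) ∧
  ∃ (ut : ℝ → Strata N → ℝ) (g : ℝ → Strata N → EuclideanSpace ℝ (Fin (N 0))),
    HasL2TimeDerivative T Ω u ut ∧
    G.HasParabolicGradient (ENNReal.ofReal D.m) T Ω u g ∧
    ∀ (φ : ℝ → Strata N → ℝ) (h : ℝ → Strata N → EuclideanSpace ℝ (Fin (N 0))),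
      ContinuousOn (fun z : ℝ × Strata N => φ z.1 z.2) (closure (Ioo 0 T ×ˢ Ω)) →
      G.HasParabolicGradient (ENNReal.ofReal D.p) T Ω φ h →
      (∀ t ∈ Ioo 0 T, ∀ x ∈ Ω, 0 ≤ φ t x) →
      (∀ t ∈ Ioo 0 T, ∀ x ∈ frontier Ω, φ t x = 0) →
      R (∫ z in Ioo 0 T ×ˢ Ω, (ut z.1 z.2 * φ z.1 z.2 +
            ‖g z.1 z.2‖ ^ (D.p - 2) * inner ℝ (g z.1 z.2) (h z.1 z.2)))
        (∫ z in Ioo 0 T ×ˢ Ω, D.source (u z.1 z.2) * φ z.1 z.2)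

/-- Nonnegative weak super-solutions on `(0,T) × Ω`. -/
def IsWeakSupersolution (G : StratifiedGroup N) (Ω : Set (Strata N)) (T : ℝ)
    (u : ℝ → Strata N → ℝ) : Prop :=
  D.IsWeak (fun a b => a ≥ b) G Ω T u

/-- Nonnegative weak sub-solutions on `(0,T) × Ω`. -/
def IsWeakSubsolution (G : StratifiedGroup N) (Ω : Set (Strata N)) (T : ℝ)
    (u : ℝ → Strata N → ℝ) : Prop :=
  D.IsWeak (fun a b => a ≤ b) G Ω T u

/-- A weak solution is both a weak super-solution and a weak sub-solution. -/
def IsWeakSolution (G : StratifiedGroup N) (Ω : Set (Strata N)) (T : ℝ)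
    (u : ℝ → Strata N → ℝ) : Prop :=
  D.IsWeakSupersolution G Ω T u ∧ D.IsWeakSubsolution G Ω T u

end HeatData

end

/-! The stronger power carries the negative coefficient, so the source is nonpositive above some
level. Take `M ≥ 0` above that level and above the essential supremum of `u₀`; the bound is then a
weak maximum principle, `IsWeakSubsolution.le_of_source_nonpos`.

Let `F` be a smooth substitute for `(y - M)₊`, let `Φ' = F` with `Φ = 0` below `M`, and test the
sub-solution inequality with `(b - t)₊ F(u)`. The diffusion term is the integral of `(b - t)₊ F'(u)
|∇_H u|^p`, which is nonnegative, and the source term is nonpositive. Hence the integral of `∂_t u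
(b - t)₊ F(u)` is nonpositive. Integration by parts in `t` turns it into the integral of `Φ(u) ≥ 0`
over `(0,b) × Ω`, so `Φ(u)` vanishes there and `u ≤ M`.

Two facts justify this for weak solutions. The chain rule `HasSobolevGradient.comp` makes the test
function admissible, and `ae_forall_eq_add_primitive` makes `u(·,x)` absolutely continuous for
almost every `x`, although `∂_t u` is only a distributional derivative. -/

/-! ### Distributional derivatives in one variable. -/

/-- A smooth function with compact support in `(0,T)` and integral zero has a primitive of the
same kind. -/
theorem exists_primitive_of_integral_eq_zero {T : ℝ} (hT : 0 < T) {θ : ℝ → ℝ}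
    (hθ : ContDiff ℝ ∞ θ) (hc : HasCompactSupport θ) (hs : tsupport θ ⊆ Ioo 0 T)
    (h0 : ∫ t, θ t = 0) :
    ∃ ψ : ℝ → ℝ, ContDiff ℝ ∞ ψ ∧ HasCompactSupport ψ ∧ tsupport ψ ⊆ Ioo 0 T ∧
      deriv ψ = θ := by
  obtain ⟨a, b, ha, hb, hab, hK⟩ : ∃ a b : ℝ, 0 < a ∧ b < T ∧ a ≤ b ∧ tsupport θ ⊆ Icc a b := by
    rcases (tsupport θ).eq_empty_or_nonempty with he | hne
    · exact ⟨T / 2, T / 2, by linarith, by linarith, le_rfl, by simp [he]⟩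
    · obtain ⟨a, ha⟩ := IsCompact.exists_isLeast hc hne
      obtain ⟨b, hb⟩ := IsCompact.exists_isGreatest hc hne
      exact ⟨a, b, (hs ha.1).1, (hs hb.1).2, ha.2 hb.1, fun x hx => ⟨ha.2 hx, hb.2 hx⟩⟩
  have hzero : ∀ t, t ∉ Icc a b → θ t = 0 := fun t ht =>
    image_eq_zero_of_notMem_tsupport fun h => ht (hK h)
  have hd : deriv (fun t => ∫ s in a..t, θ s) = θ := by
    ext t
    exact hθ.continuous.deriv_integral _ _ _
  have hout : ∀ t, t ∉ Icc a b → ∫ s in a..t, θ s = 0 := by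
    intro t ht
    rcases lt_or_ge t a with h | h
    · rw [intervalIntegral.integral_symm, intervalIntegral.integral_zero_ae, neg_zero]
      refine ae_iff.2 ?_
      -- The endpoint `a` is a null set, so the value of `θ` there need not be examined.
      refine measure_mono_null (t := {a}) ?_ (by simp)
      intro s hs
      simp only [mem_ofPred_eq, Classical.not_imp, uIoc_of_le h.le] at hs
      by_contra hsa
      exact hs.2 (hzero s fun h' => hsa (le_antisymm hs.1.2 h'.1))
    · have hbt : b < t := by
        by_contra h'
        exact ht ⟨h, not_lt.1 h'⟩
      -- Beyond `b` the primitive has collected the whole integral of `θ`, which is zero.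
      rw [intervalIntegral.integral_of_le h, ← h0, ← integral_indicator measurableSet_Ioc]
      refine integral_congr_ae ?_
      refine ae_iff.2 ?_
      refine measure_mono_null (t := {a}) ?_ (by simp)
      intro s hs
      by_contra hsa
      refine hs ?_
      by_cases h' : s ∈ Ioc a t
      · simp [h']
      · simp only [h', not_false_eq_true, indicator_of_notMem]
        refine (hzero s fun h'' => h' ⟨lt_of_le_of_ne h''.1 (Ne.symm hsa), h''.2.trans hbt.le⟩).symm
  have hcd : ContDiff ℝ ∞ (fun t => ∫ s in a..t, θ s) := by
    rw [contDiff_infty_iff_deriv, hd]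
    exact ⟨fun t => (hθ.continuous.integral_hasStrictDerivAt a t).hasDerivAt.differentiableAt, hθ⟩
  refine ⟨_, hcd, HasCompactSupport.intro isCompact_Icc hout, ?_, hd⟩
  refine Subset.trans (closure_minimal ?_ isClosed_Icc) (Icc_subset_Ioo ha hb)
  intro t ht
  by_contra h
  exact ht (hout t h)

/-- A smooth function with compact support in `(0,T)` has vanishing boundary values. -/
theorem eq_zero_of_tsupport_subset_Ioo {T : ℝ} {ψ : ℝ → ℝ} (hs : tsupport ψ ⊆ Ioo 0 T) :
    ψ 0 = 0 ∧ ψ T = 0 :=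
  ⟨image_eq_zero_of_notMem_tsupport fun h => (lt_irrefl _ (hs h).1),
    image_eq_zero_of_notMem_tsupport fun h => (lt_irrefl _ (hs h).2)⟩

theorem setIntegral_Ioo_eq_intervalIntegral {T : ℝ} (hT : 0 < T) (f : ℝ → ℝ) :
    ∫ t in Ioo 0 T, f t = ∫ t in (0 : ℝ)..T, f t := by
  rw [intervalIntegral.integral_of_le hT.le, integral_Ioc_eq_integral_Ioo]

/-- The lemma of du Bois-Reymond. -/
theorem exists_eq_const_of_integral_mul_deriv_eq_zero {T : ℝ} (hT : 0 < T) {Z : ℝ → ℝ}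
    (hZ : ContinuousOn Z (Ioo 0 T))
    (h : ∀ ψ : ℝ → ℝ, ContDiff ℝ ∞ ψ → HasCompactSupport ψ → tsupport ψ ⊆ Ioo 0 T →
      ∫ t in Ioo 0 T, Z t * deriv ψ t = 0) :
    ∃ c, ∀ t ∈ Ioo 0 T, Z t = c := by
  let ρ : ContDiffBump (T / 2) := ⟨T / 8, T / 4, by linarith, by linarith⟩
  have hρs : tsupport (ρ.normed volume) ⊆ Ioo 0 T := by
    rw [ρ.tsupport_normed_eq, Real.closedBall_eq_Icc]
    change Icc (T / 2 - T / 4) (T / 2 + T / 4) ⊆ _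
    exact Icc_subset_Ioo (by linarith) (by linarith)
  have hint : ∀ χ : ℝ → ℝ, Continuous χ → HasCompactSupport χ → tsupport χ ⊆ Ioo 0 T →
      Integrable (fun t => Z t * χ t) := by
    intro χ hχ hc hs
    have : IntegrableOn (fun t => Z t * χ t) (tsupport χ) :=
      ContinuousOn.integrableOn_compact hc ((hZ.mono hs).mul hχ.continuousOn)
    refine (integrableOn_iff_integrable_of_support_subset ?_).1 this
    intro t ht
    refine subset_tsupport _ fun h0 => ht ?_
    simp [h0]
  have hset : ∀ χ : ℝ → ℝ, tsupport χ ⊆ Ioo 0 T →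
      ∫ t in Ioo 0 T, Z t * χ t = ∫ t, Z t * χ t := by
    intro χ hs
    refine setIntegral_eq_integral_of_forall_compl_eq_zero fun t ht => ?_
    rw [image_eq_zero_of_notMem_tsupport fun h => ht (hs h), mul_zero]
  set c := ∫ t, Z t * ρ.normed volume t with hcdef
  have key : ∀ᵐ t, t ∈ Ioo 0 T → Z t - c = 0 := by
    refine isOpen_Ioo.ae_eq_zero_of_integral_contDiff_smul_eq_zero
      ((hZ.sub continuousOn_const).locallyIntegrableOn measurableSet_Ioo) ?_
    intro χ hχ hχc hχs
    set I := ∫ t, χ t with hI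
    -- Subtracting the multiple of the unit-mass bump with the same integral leaves a function of
    -- mean zero, hence the derivative of an admissible test function.
    have hθ : ContDiff ℝ ∞ (fun t => χ t - I * ρ.normed volume t) :=
      hχ.sub (contDiff_const.mul (ρ.contDiff_normed))
    have hθc : HasCompactSupport (fun t => χ t - I * ρ.normed volume t) :=
      hχc.sub (ρ.hasCompactSupport_normed.mul_left)
    have hθs : tsupport (fun t => χ t - I * ρ.normed volume t) ⊆ Ioo 0 T := by
      refine (tsupport_sub χ (fun t => I * ρ.normed volume t)).trans
        (union_subset hχs (Subset.trans ?_ hρs))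
      exact tsupport_mul_subset_right (f := fun _ => I) (g := ρ.normed volume)
    have hχi : Integrable χ := hχ.continuous.integrable_of_hasCompactSupport hχc
    have hρi : Integrable (ρ.normed volume) :=
      ρ.contDiff_normed (n := ⊤) |>.continuous.integrable_of_hasCompactSupport
        ρ.hasCompactSupport_normed
    obtain ⟨ψ, h1, h2, h3, h4⟩ := exists_primitive_of_integral_eq_zero hT hθ hθc hθs (by
      rw [integral_sub hχi (hρi.const_mul I), integral_const_mul, ρ.integral_normed]
      simp [I])
    have h5 := h ψ h1 h2 h3
    rw [h4, hset _ hθs] at h5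
    have e1 : ∫ t, Z t * (χ t - I * ρ.normed volume t) = (∫ t, Z t * χ t) - I * c := by
      rw [hcdef, ← integral_const_mul, ← integral_sub (hint χ hχ.continuous hχc hχs)
        ((hint _ (ρ.contDiff_normed (n := ⊤)).continuous ρ.hasCompactSupport_normed hρs).const_mul I)]
      congr 1 with t
      ring
    have e2 : ∫ t, χ t • (Z t - c) = (∫ t, Z t * χ t) - I * c := by
      rw [hI, ← integral_mul_const, ← integral_sub (hint χ hχ.continuous hχc hχs)
        (hχi.mul_const c)]
      congr 1 with t
      simp only [smul_eq_mul]
      ring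
    rw [e2, ← e1, h5]
  refine ⟨c, ?_⟩
  have := Measure.eqOn_open_of_ae_eq (μ := volume) (f := Z) (g := fun _ => c) (U := Ioo 0 T)
    ((ae_restrict_iff' measurableSet_Ioo).2 (key.mono fun t ht h' => sub_eq_zero.1 (ht h')))
    isOpen_Ioo hZ continuousOn_const
  exact this

/-- A continuous function with integrable distributional derivative is a primitive of it. -/
theorem exists_eq_const_add_primitive {T : ℝ} (hT : 0 < T) {W V : ℝ → ℝ}
    (hW : ContinuousOn W (Ioo 0 T)) (hWi : IntegrableOn W (Ioo 0 T))
    (hV : IntegrableOn V (Ioo 0 T))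
    (h : ∀ ψ : ℝ → ℝ, ContDiff ℝ ∞ ψ → HasCompactSupport ψ → tsupport ψ ⊆ Ioo 0 T →
      ∫ t in Ioo 0 T, W t * deriv ψ t = -∫ t in Ioo 0 T, V t * ψ t) :
    ∃ c, ∀ t ∈ Ioo 0 T, W t = c + ∫ s in (0 : ℝ)..t, V s := by
  have hVi : IntervalIntegrable V volume 0 T :=
    (intervalIntegrable_iff_integrableOn_Ioo_of_le hT.le).2 hV
  have hP := hVi.absolutelyContinuousOnInterval_intervalIntegral (c := 0) (by simp)
  have hPc : ContinuousOn (fun t => ∫ s in (0 : ℝ)..t, V s) (Icc 0 T) := by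
    simpa [uIcc_of_le hT.le] using hP.continuousOn
  -- `W` and the primitive of `V` have the same distributional derivative: integration by parts for
  -- absolutely continuous functions has no boundary terms, since `ψ` vanishes at `0` and `T`.
  obtain ⟨c, hc⟩ := exists_eq_const_of_integral_mul_deriv_eq_zero hT
    (Z := fun t => W t - ∫ s in (0 : ℝ)..t, V s) (hW.sub (hPc.mono Ioo_subset_Icc_self)) (by
      intro ψ h1 h2 h3
      have hψac : AbsolutelyContinuousOnInterval ψ 0 T :=
        (h1.contDiffOn.of_le (by exact_mod_cast le_top)).absolutelyContinuousOnInterval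
      have hψ' : Continuous (deriv ψ) := (contDiff_infty_iff_deriv.1 h1).2.continuous
      have hb := eq_zero_of_tsupport_subset_Ioo h3
      have ibp := hψac.integral_mul_deriv_eq_deriv_mul hP
      rw [hb.1, hb.2] at ibp
      have e : ∫ t in (0 : ℝ)..T, ψ t * deriv (fun t => ∫ s in (0 : ℝ)..t, V s) t =
          ∫ t in (0 : ℝ)..T, ψ t * V t := by
        refine intervalIntegral.integral_congr_ae ?_
        filter_upwards [hVi.ae_hasDerivAt_integral] with t ht htm
        rw [(ht (uIoc_subset_uIcc htm) 0 (by simp)).deriv]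
      rw [e] at ibp
      have h5 := h ψ h1 h2 h3
      obtain ⟨C, hC⟩ := (h2.deriv).exists_bound_of_continuous hψ'
      have i1 : IntegrableOn (fun t => W t * deriv ψ t) (Ioo 0 T) :=
        hWi.mul_bdd (c := C) hψ'.aestronglyMeasurable (ae_of_all _ hC)
      have i2 : IntegrableOn (fun t => (∫ s in (0 : ℝ)..t, V s) * deriv ψ t) (Ioo 0 T) :=
        ((hPc.mul hψ'.continuousOn).integrableOn_compact isCompact_Icc).mono_set
          Ioo_subset_Icc_self
      have e3 : ∫ t in Ioo 0 T, (W t - ∫ s in (0 : ℝ)..t, V s) * deriv ψ t =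
          (∫ t in Ioo 0 T, W t * deriv ψ t) -
            ∫ t in Ioo 0 T, (∫ s in (0 : ℝ)..t, V s) * deriv ψ t := by
        rw [← integral_sub i1 i2]
        congr 1 with t
        ring
      rw [e3, h5, setIntegral_Ioo_eq_intervalIntegral hT, setIntegral_Ioo_eq_intervalIntegral hT]
      simp only [mul_comm (V _), mul_comm _ (deriv ψ _), zero_mul, sub_zero, zero_sub] at ibp ⊢
      rw [ibp]
      ring)
  exact ⟨c, fun t ht => by have := hc t ht; linarith⟩

/-! ### Absolute continuity of compositions and weighted integration by parts. -/

theorem LipschitzOnWith.comp_absolutelyContinuousOnInterval {f g : ℝ → ℝ} {a b : ℝ} {s : Set ℝ}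
    {K : NNReal} (hg : LipschitzOnWith K g s) (hf : AbsolutelyContinuousOnInterval f a b)
    (hs : MapsTo f (uIcc a b) s) :
    AbsolutelyContinuousOnInterval (g ∘ f) a b := by
  rw [absolutelyContinuousOnInterval_iff] at hf ⊢
  intro ε hε
  -- `K + 1` instead of `K` allows the Lipschitz constant to be zero.
  obtain ⟨δ, hδ, H⟩ := hf (ε / (K + 1)) (by positivity)
  refine ⟨δ, hδ, fun E hE hlt => ?_⟩
  have hE' := hE.1
  calc ∑ i ∈ Finset.range E.1, dist ((g ∘ f) (E.2 i).1) ((g ∘ f) (E.2 i).2)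
      ≤ ∑ i ∈ Finset.range E.1, (K + 1) * dist (f (E.2 i).1) (f (E.2 i).2) := by
        refine Finset.sum_le_sum fun i hi => ?_
        refine (hg.dist_le_mul _ (hs (hE' i hi).1) _ (hs (hE' i hi).2)).trans ?_
        gcongr
        linarith
    _ < ε := by
        rw [← Finset.mul_sum]
        have := H E hE hlt
        rw [lt_div_iff₀ (by positivity)] at this
        linarith

/-- Integration by parts against the weight `b - t` for a composition `Φ ∘ y` with `y` absolutely
continuous. -/
theorem integral_sub_mul_deriv_comp {b y₀ : ℝ} {v F Φ : ℝ → ℝ}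
    (hv : IntervalIntegrable v volume 0 b) (hF : Continuous F) (hΦ : ∀ z, HasDerivAt Φ (F z) z)
    (h0 : Φ y₀ = 0) :
    ∫ t in (0 : ℝ)..b, v t * ((b - t) * F (y₀ + ∫ s in (0 : ℝ)..t, v s)) =
      ∫ t in (0 : ℝ)..b, Φ (y₀ + ∫ s in (0 : ℝ)..t, v s) := by
  have hP := hv.absolutelyContinuousOnInterval_intervalIntegral (c := 0) (by simp)
  have hy : AbsolutelyContinuousOnInterval (fun t => y₀ + ∫ s in (0 : ℝ)..t, v s) 0 b := by
    have : AbsolutelyContinuousOnInterval (fun _ : ℝ => y₀) 0 b :=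
      (contDiff_const.contDiffOn).absolutelyContinuousOnInterval
    exact this.add hP
  have hΦ1 : ContDiff ℝ 1 Φ := by
    rw [contDiff_one_iff_deriv]
    refine ⟨fun z => (hΦ z).differentiableAt, ?_⟩
    rwa [show deriv Φ = F from funext fun z => (hΦ z).deriv]
  -- The path stays in a compact interval, on which the `C¹` function `Φ` is Lipschitz.
  obtain ⟨C, hC⟩ := hy.exists_bound
  obtain ⟨K, hK⟩ := (hΦ1.contDiffOn (s := Icc (-C) C)).exists_lipschitzOnWith (by decide)
    (convex_Icc _ _) isCompact_Icc
  have hg := hK.comp_absolutelyContinuousOnInterval hy fun t ht => abs_le.1 (hC t ht)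
  have hf : AbsolutelyContinuousOnInterval (fun t : ℝ => b - t) 0 b :=
    ((contDiff_const.sub contDiff_id).contDiffOn).absolutelyContinuousOnInterval
  -- Both boundary terms vanish: at `b` because of the weight, at `0` because `Φ y₀ = 0`. The
  -- derivative `-1` of the weight leaves the plain integral of `Φ`.
  have ibp := hf.integral_mul_deriv_eq_deriv_mul hg
  have e1 : ∫ t in (0 : ℝ)..b, (b - t) *
        deriv (Φ ∘ fun t => y₀ + ∫ s in (0 : ℝ)..t, v s) t =
      ∫ t in (0 : ℝ)..b, v t * ((b - t) * F (y₀ + ∫ s in (0 : ℝ)..t, v s)) := by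
    refine intervalIntegral.integral_congr_ae ?_
    filter_upwards [hv.ae_hasDerivAt_integral] with t ht htm
    have := (ht (uIoc_subset_uIcc htm) 0 (by simp)).const_add y₀
    rw [((hΦ _).comp t this).deriv]
    ring
  rw [← e1, ibp]
  simp [h0]

/-! ### Absolute continuity in time for almost every point of `Ω`. -/

/-- A function which is continuous on `[0,T) × Ω` and has an integrable distributional time
derivative is, for almost every `x`, the primitive of that derivative. -/
theorem ae_forall_eq_add_primitive {k : ℕ} {N : Fin (k + 1) → ℕ} {T : ℝ} (hT : 0 < T)
    {Ω : Set (Strata N)} (hΩ : IsOpen Ω) {u v : ℝ → Strata N → ℝ}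
    (hu : ContinuousOn (fun z : ℝ × Strata N => u z.1 z.2) (Ico 0 T ×ˢ Ω))
    (hui : IntegrableOn (fun z : ℝ × Strata N => u z.1 z.2) (Ioo 0 T ×ˢ Ω))
    (hvi : IntegrableOn (fun z : ℝ × Strata N => v z.1 z.2) (Ioo 0 T ×ˢ Ω))
    (hd : ∀ ψ : ℝ × Strata N → ℝ, ContDiff ℝ ∞ ψ → HasCompactSupport ψ →
      tsupport ψ ⊆ Ioo 0 T ×ˢ Ω →
      ∫ z in Ioo 0 T ×ˢ Ω, u z.1 z.2 * fderiv ℝ ψ z (1, 0) =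
        -∫ z in Ioo 0 T ×ˢ Ω, v z.1 z.2 * ψ z) :
    ∀ᵐ x ∂(volume.restrict Ω), IntegrableOn (fun t => v t x) (Ioo 0 T) ∧
      ∀ t ∈ Ico 0 T, u t x = u 0 x + ∫ s in (0 : ℝ)..t, v s x := by
  have hprod : (volume : Measure (ℝ × Strata N)).restrict (Ioo 0 T ×ˢ Ω) =
      (volume.restrict (Ioo 0 T)).prod (volume.restrict Ω) := by
    rw [Measure.prod_restrict, Measure.volume_eq_prod]
  have hmul : ∀ {w : ℝ × Strata N → ℝ} {b : ℝ × Strata N → ℝ}, IntegrableOn w (Ioo 0 T ×ˢ Ω) →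
      Continuous b → (∃ C, ∀ z, ‖b z‖ ≤ C) →
      IntegrableOn (fun z => w z * b z) (Ioo 0 T ×ˢ Ω) := by
    rintro w b hw hb ⟨C, hC⟩
    exact Integrable.mul_bdd (c := C) hw hb.aestronglyMeasurable (ae_of_all _ hC)
  have hcu : ∀ t ∈ Ico 0 T, ContinuousOn (u t) Ω := fun t ht =>
    hu.comp (f := fun x => (t, x)) (by fun_prop) fun x hx => ⟨ht, hx⟩
  have hvb : ∀ b ∈ Ioo 0 T, Integrable (fun z : ℝ × Strata N => v z.1 z.2)
      ((volume.restrict (Ioc 0 b)).prod (volume.restrict Ω)) := by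
    intro b hb
    rw [Measure.prod_restrict, ← Measure.volume_eq_prod]
    exact IntegrableOn.mono_set hvi (prod_mono (fun t ht => ⟨ht.1, ht.2.trans_lt hb.2⟩) le_rfl)
  -- Pairing with `χ` in space, through test functions `θ(t) χ(x)`, reduces the claim to one
  -- variable.
  have hweak : ∀ χ : Strata N → ℝ, ContDiff ℝ ∞ χ → HasCompactSupport χ → tsupport χ ⊆ Ω →
      ∀ b ∈ Ioo 0 T, (∫ x in Ω, u b x * χ x) =
        (∫ x in Ω, u 0 x * χ x) + ∫ t in (0 : ℝ)..b, ∫ x in Ω, v t x * χ x := by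
    intro χ hχ hχc hχs
    obtain ⟨Cχ, hCχ⟩ := hχc.exists_bound_of_continuous hχ.continuous
    have hW : ContinuousOn (fun t => ∫ x in Ω, u t x * χ x) (Ico 0 T) := by
      have e : (fun t => ∫ x in Ω, u t x * χ x) = fun t => ∫ x, u t x * χ x := by
        ext t
        refine setIntegral_eq_integral_of_forall_compl_eq_zero fun x hx => ?_
        rw [image_eq_zero_of_notMem_tsupport fun h => hx (hχs h), mul_zero]
      rw [e]
      refine continuousOn_integral_of_compact_support (k := tsupport χ) hχc ?_ ?_
      · rintro ⟨t, x⟩ ⟨ht, -⟩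
        by_cases hx : x ∈ tsupport χ
        · have h1 : ContinuousWithinAt (fun z : ℝ × Strata N => u z.1 z.2 * χ z.2)
              (Ico 0 T ×ˢ Ω) (t, x) :=
            (hu (t, x) ⟨ht, hχs hx⟩).mul (hχ.continuous.comp continuous_snd).continuousWithinAt
          refine h1.mono_of_mem_nhdsWithin ?_
          rw [nhdsWithin_prod_eq, nhdsWithin_univ]
          exact prod_mem_prod self_mem_nhdsWithin (hΩ.mem_nhds (hχs hx))
        · have h1 : (fun z : ℝ × Strata N => u z.1 z.2 * χ z.2) =ᶠ[𝓝 (t, x)] fun _ => 0 := by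
            have : ∀ᶠ y in 𝓝 x, y ∉ tsupport χ :=
              (isClosed_tsupport χ).isOpen_compl.mem_nhds hx
            filter_upwards [(continuous_snd.tendsto (t, x)).eventually this] with z hz
            rw [image_eq_zero_of_notMem_tsupport hz, mul_zero]
          exact (continuousAt_const.congr h1.symm).continuousWithinAt
      · intro t x _ hx
        rw [image_eq_zero_of_notMem_tsupport hx, mul_zero]
    have hbd : ∃ C, ∀ z : ℝ × Strata N, ‖χ z.2‖ ≤ C := ⟨Cχ, fun z => hCχ z.2⟩
    have hWi : IntegrableOn (fun t => ∫ x in Ω, u t x * χ x) (Ioo 0 T) := by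
      have := hmul hui (hχ.continuous.comp continuous_snd) hbd
      rw [IntegrableOn, hprod] at this
      exact this.integral_prod_left
    have hVi : IntegrableOn (fun t => ∫ x in Ω, v t x * χ x) (Ioo 0 T) := by
      have := hmul hvi (hχ.continuous.comp continuous_snd) hbd
      rw [IntegrableOn, hprod] at this
      exact this.integral_prod_left
    obtain ⟨c, hc⟩ := exists_eq_const_add_primitive hT (hW.mono Ioo_subset_Ico_self) hWi hVi (by
      intro θ h1 h2 h3
      have hψ : ContDiff ℝ ∞ (fun z : ℝ × Strata N => θ z.1 * χ z.2) :=
        (h1.comp contDiff_fst).mul (hχ.comp contDiff_snd)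
      have hsub : tsupport (fun z : ℝ × Strata N => θ z.1 * χ z.2) ⊆ tsupport θ ×ˢ tsupport χ := by
        refine closure_minimal ?_ ((isClosed_tsupport θ).prod (isClosed_tsupport χ))
        intro z hz
        exact ⟨subset_tsupport _ (left_ne_zero_of_mul hz),
          subset_tsupport _ (right_ne_zero_of_mul hz)⟩
      have hcs : HasCompactSupport (fun z : ℝ × Strata N => θ z.1 * χ z.2) :=
        IsCompact.of_isClosed_subset (IsCompact.prod h2 hχc) (isClosed_tsupport _) hsub
      have h := hd _ hψ hcs (hsub.trans (prod_mono h3 hχs))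
      have hder : ∀ z : ℝ × Strata N, fderiv ℝ (fun z : ℝ × Strata N => θ z.1 * χ z.2) z (1, 0) =
          deriv θ z.1 * χ z.2 := by
        intro z
        have d1 : HasFDerivAt (fun z : ℝ × Strata N => θ z.1)
            ((fderiv ℝ θ z.1).comp (ContinuousLinearMap.fst ℝ ℝ (Strata N))) z :=
          (h1.differentiable (by simp) z.1).hasFDerivAt.comp z hasFDerivAt_fst
        have d2 : HasFDerivAt (fun z : ℝ × Strata N => χ z.2)
            ((fderiv ℝ χ z.2).comp (ContinuousLinearMap.snd ℝ ℝ (Strata N))) z :=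
          (hχ.differentiable (by simp) z.2).hasFDerivAt.comp z hasFDerivAt_snd
        rw [HasFDerivAt.fderiv (f := fun z : ℝ × Strata N => θ z.1 * χ z.2) (d1.mul d2)]
        simp [mul_comm]
      simp_rw [hder] at h
      have hθ' : Continuous (deriv θ) := (contDiff_infty_iff_deriv.1 h1).2.continuous
      obtain ⟨C1, hC1⟩ := h2.deriv.exists_bound_of_continuous hθ'
      obtain ⟨C2, hC2⟩ := h2.exists_bound_of_continuous h1.continuous
      have i1 := hmul hui (b := fun z => deriv θ z.1 * χ z.2)
        ((hθ'.comp continuous_fst).mul (hχ.continuous.comp continuous_snd))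
        ⟨C1 * Cχ, fun z => by
          rw [norm_mul]
          exact mul_le_mul (hC1 _) (hCχ _) (norm_nonneg _) ((norm_nonneg _).trans (hC1 0))⟩
      have i2 := hmul hvi (b := fun z => θ z.1 * χ z.2) hψ.continuous
        ⟨C2 * Cχ, fun z => by
          rw [norm_mul]
          exact mul_le_mul (hC2 _) (hCχ _) (norm_nonneg _) ((norm_nonneg _).trans (hC2 0))⟩
      rw [Measure.volume_eq_prod] at h i1 i2
      rw [setIntegral_prod _ i1, setIntegral_prod _ i2] at h
      convert h using 2
      · ext t
        rw [← integral_mul_const]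
        congr 1 with x
        ring
      · congr 1 with t
        rw [← integral_mul_const]
        congr 1 with x
        ring)
    have hVint : IntervalIntegrable (fun t => ∫ x in Ω, v t x * χ x) volume 0 T :=
      (intervalIntegrable_iff_integrableOn_Ioo_of_le hT.le).2 hVi
    have hPc : ContinuousOn (fun b => ∫ t in (0 : ℝ)..b, ∫ x in Ω, v t x * χ x) (Ico 0 T) := by
      have := (hVint.absolutelyContinuousOnInterval_intervalIntegral (c := 0)
        (by simp)).continuousOn
      rw [uIcc_of_le hT.le] at this
      exact this.mono Ico_subset_Icc_self
    -- The distributional identity sees only `t > 0`; continuity up to `t = 0` identifies the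
    -- constant `c` with the initial pairing.
    have heq : EqOn (fun t => ∫ x in Ω, u t x * χ x)
        (fun b => c + ∫ t in (0 : ℝ)..b, ∫ x in Ω, v t x * χ x) (Ico 0 T) :=
      EqOn.of_subset_closure (s := Ioo 0 T) hc hW (continuousOn_const.add hPc)
        Ioo_subset_Ico_self (by rw [closure_Ioo hT.ne]; exact Ico_subset_Icc_self)
    have h0 := heq (left_mem_Ico.2 hT)
    simp only [intervalIntegral.integral_same, add_zero] at h0
    intro b hb
    rw [h0]
    exact hc b hb
  have hpt : ∀ b ∈ Ioo 0 T, ∀ᵐ x, x ∈ Ω → u b x - u 0 x - ∫ t in Ioc 0 b, v t x = 0 := by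
    intro b hb
    have hPi : IntegrableOn (fun x => ∫ t in Ioc 0 b, v t x) Ω := (hvb b hb).integral_prod_right
    have hcb : ContinuousOn (fun x => u b x - u 0 x) Ω :=
      (hcu b ⟨hb.1.le, hb.2⟩).sub (hcu 0 (left_mem_Ico.2 hT))
    refine hΩ.ae_eq_zero_of_integral_contDiff_smul_eq_zero
      ((hcb.locallyIntegrableOn hΩ.measurableSet).sub hPi.locallyIntegrableOn) ?_
    intro χ hχ hχc hχs
    have h := hweak χ hχ hχc hχs b hb
    obtain ⟨C, hC⟩ := hχc.exists_bound_of_continuous hχ.continuous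
    have hci : ∀ t ∈ Ico 0 T, IntegrableOn (fun x => u t x * χ x) Ω := by
      intro t ht
      have : IntegrableOn (fun x => u t x * χ x) (tsupport χ) :=
        (((hcu t ht).mono hχs).mul hχ.continuous.continuousOn).integrableOn_compact hχc
      refine Integrable.integrableOn ((integrableOn_iff_integrable_of_support_subset ?_).1 this)
      intro x hx
      exact subset_tsupport _ (right_ne_zero_of_mul hx)
    have hPχ : IntegrableOn (fun x => (∫ t in Ioc 0 b, v t x) * χ x) Ω :=
      hPi.mul_bdd (c := C) hχ.continuous.aestronglyMeasurable (ae_of_all _ hC)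
    have hsw : ∫ t in (0 : ℝ)..b, ∫ x in Ω, v t x * χ x =
        ∫ x in Ω, (∫ t in Ioc 0 b, v t x) * χ x := by
      rw [intervalIntegral.integral_of_le hb.1.le, integral_integral_swap]
      · congr 1 with x
        rw [integral_mul_const]
      · exact (hvb b hb).mul_bdd (c := C)
          (hχ.continuous.comp continuous_snd).aestronglyMeasurable (ae_of_all _ fun z => hC z.2)
    have e : ∫ x, χ x • (u b x - u 0 x - ∫ t in Ioc 0 b, v t x) =
        ∫ x in Ω, (u b x * χ x - u 0 x * χ x - (∫ t in Ioc 0 b, v t x) * χ x) := by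
      rw [setIntegral_eq_integral_of_forall_compl_eq_zero]
      · congr 1 with x
        simp only [smul_eq_mul]
        ring
      · intro x hx
        rw [image_eq_zero_of_notMem_tsupport fun h => hx (hχs h)]
        simp
    have i1 := hci b ⟨hb.1.le, hb.2⟩
    have i2 := hci 0 (left_mem_Ico.2 hT)
    rw [e, integral_sub (f := fun x => u b x * χ x - u 0 x * χ x) (i1.sub i2) hPχ, integral_sub i1 i2, h, hsw]
    ring
  -- The exceptional null set depends on `b`. Rational times give one common null set, and
  -- continuity in time then covers all of `[0,T)`.
  have hall : ∀ᵐ x, ∀ b : ℚ, (b : ℝ) ∈ Ioo 0 T → x ∈ Ω →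
      u b x - u 0 x - ∫ t in Ioc 0 (b : ℝ), v t x = 0 := by
    rw [ae_all_iff]
    intro b
    by_cases hb : (b : ℝ) ∈ Ioo 0 T
    · filter_upwards [hpt b hb] with x hx _ using hx
    · exact ae_of_all _ fun x h => absurd h hb
  have hsl : ∀ᵐ x ∂(volume.restrict Ω), IntegrableOn (fun t => v t x) (Ioo 0 T) := by
    rw [IntegrableOn, hprod] at hvi
    exact hvi.prod_left_ae
  filter_upwards [hsl, (ae_restrict_iff' hΩ.measurableSet).2
    (hall.mono fun x hx hxΩ b hb => hx b hb hxΩ), ae_restrict_mem hΩ.measurableSet]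
    with x hx1 hx2 hxΩ
  refine ⟨hx1, ?_⟩
  have hvint : IntervalIntegrable (fun t => v t x) volume 0 T :=
    (intervalIntegrable_iff_integrableOn_Ioo_of_le hT.le).2 hx1
  have hPc : ContinuousOn (fun b => ∫ t in (0 : ℝ)..b, v t x) (Ico 0 T) := by
    have := (hvint.absolutelyContinuousOnInterval_intervalIntegral (c := 0) (by simp)).continuousOn
    rw [uIcc_of_le hT.le] at this
    exact this.mono Ico_subset_Icc_self
  have hux : ContinuousOn (fun t => u t x) (Ico 0 T) :=
    hu.comp (f := fun t => (t, x)) (by fun_prop) fun t ht => ⟨ht, hxΩ⟩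
  refine EqOn.of_subset_closure (s := Ioo 0 T ∩ range ((↑) : ℚ → ℝ)) ?_ hux
    (continuousOn_const.add hPc) (inter_subset_left.trans Ioo_subset_Ico_self) ?_
  · rintro _ ⟨ht, b, rfl⟩
    have := hx2 b ht
    rw [← intervalIntegral.integral_of_le ht.1.le] at this
    simp only
    linarith
  · refine Subset.trans ?_ (closure_minimal
      ((Rat.denseRange_cast (𝕜 := ℝ)).open_subset_closure_inter isOpen_Ioo) isClosed_closure)
    rw [closure_Ioo hT.ne]
    exact Ico_subset_Icc_self

/-! ### Horizontal gradients and the chain rule in the Sobolev space. -/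

/-- Dominated convergence with majorant `‖C • g‖ ^ p`. In the chain rule the coefficients `F'(f) -
F'(φ_n)` are bounded and tend to zero only almost everywhere, which is enough here. -/
theorem tendsto_eLpNorm_smul_zero_of_dominated {X E : Type*} [MeasurableSpace X] {μ : Measure X}
    [NormedAddCommGroup E] [NormedSpace ℝ E] {p : ℝ≥0∞} (hp0 : p ≠ 0) (hp : p ≠ ⊤)
    {a : ℕ → X → ℝ} {g : X → E} {C : ℝ} (ha : ∀ n, AEStronglyMeasurable (a n) μ)
    (haC : ∀ n x, |a n x| ≤ C) (hg : MemLp g p μ)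
    (hlim : ∀ᵐ x ∂μ, Tendsto (fun n => a n x) atTop (𝓝 0)) :
    Tendsto (fun n => eLpNorm (fun x => a n x • g x) p μ) atTop (𝓝 0) := by
  have hpr : 0 < p.toReal := ENNReal.toReal_pos hp0 hp
  have hfin : ∫⁻ x, ‖C • g x‖ₑ ^ p.toReal ∂μ ≠ ⊤ :=
    (lintegral_rpow_enorm_lt_top_of_eLpNorm_lt_top hp0 hp (hg.const_smul C).2).ne
  have key : Tendsto (fun n => ∫⁻ x, ‖a n x • g x‖ₑ ^ p.toReal ∂μ) atTop
      (𝓝 (∫⁻ _, 0 ∂μ)) := by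
    refine tendsto_lintegral_of_dominated_convergence' (fun x => ‖C • g x‖ₑ ^ p.toReal)
      (fun n => (((ha n).smul hg.1).enorm).pow_const _) (fun n => ae_of_all _ fun x => ?_) hfin ?_
    · refine ENNReal.rpow_le_rpow ?_ hpr.le
      rw [enorm_le_iff_norm_le, norm_smul, norm_smul]
      exact mul_le_mul_of_nonneg_right ((haC n x).trans (le_abs_self C)) (norm_nonneg _)
    · filter_upwards [hlim] with x hx
      have h1 : Tendsto (fun n => ‖a n x • g x‖ₑ) atTop (𝓝 0) := by
        have := (hx.smul_const (g x)).enorm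
        simpa using this
      have h2 := (ENNReal.continuous_rpow_const (y := p.toReal)).tendsto (0 : ℝ≥0∞)
      rw [ENNReal.zero_rpow_of_pos hpr] at h2
      exact h2.comp h1
  simp_rw [eLpNorm_eq_lintegral_rpow_enorm_toReal hp0 hp]
  have h2 := (ENNReal.continuous_rpow_const (y := 1 / p.toReal)).tendsto (0 : ℝ≥0∞)
  rw [ENNReal.zero_rpow_of_pos (by positivity)] at h2
  rw [lintegral_zero] at key
  exact h2.comp key

namespace StratifiedGroup

variable {k : ℕ} {N : Fin (k + 1) → ℕ} (G : StratifiedGroup N)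

/-- Joint continuity of the group law makes the derivative of the left translation measurable in its
parameter. -/
theorem measurable_X (j : Fin (N 0)) : Measurable (G.X j) := by
  let _ := G.group
  have := G.lieGroup
  have : IsTopologicalGroup (Strata N) :=
    topologicalGroup_of_lieGroup 𝓘(ℝ, Strata N) ∞
  have h := measurable_fderiv_apply_const_with_param ℝ
    (f := fun x y : Strata N => x * y) (by exact continuous_mul) (Strata.horizontalBasis j)
  exact h.comp (measurable_id.prodMk measurable_const)

theorem measurable_horizontalGradient {φ : Strata N → ℝ} (hφ : ContDiff ℝ ∞ φ) :
    Measurable (G.horizontalGradient φ) := by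
  refine (PiLp.continuous_toLp 2 _).measurable.comp (measurable_pi_lambda _ fun j => ?_)
  have hc : Continuous fun z : Strata N × Strata N => fderiv ℝ φ z.1 z.2 :=
    ((hφ.continuous_fderiv (by simp)).comp continuous_fst).clm_apply continuous_snd
  exact hc.measurable.comp (measurable_id.prodMk (G.measurable_X j))

theorem horizontalGradient_comp {F φ : Strata N → ℝ} {f F' : ℝ → ℝ}
    (hf : ∀ y, HasDerivAt f (F' y) y) (hφ : Differentiable ℝ φ) (hF : F = f ∘ φ) :
    G.horizontalGradient F = fun x => F' (φ x) • G.horizontalGradient φ x := by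
  ext x j
  subst hF
  have h := (hf (φ x)).comp_hasFDerivAt x (hφ x).hasFDerivAt
  simp [horizontalGradient, h.fderiv]

/-- Chain rule in `S₀^{1,p}(Ω)`, together with the inclusion `S₀^{1,m}(Ω) ⊆ S₀^{1,p}(Ω)` for
`p ≤ m` and `Ω` of finite measure. -/
theorem HasSobolevGradient.comp {p m : ℝ≥0∞} (hp1 : 1 ≤ p) (hpm : p ≤ m) (hm : m ≠ ⊤)
    {Ω : Set (Strata N)} (hΩ : volume Ω ≠ ⊤) {f : Strata N → ℝ}
    {g : Strata N → EuclideanSpace ℝ (Fin (N 0))} (h : G.HasSobolevGradient m Ω f g)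
    {F F' : ℝ → ℝ} (hF : ContDiff ℝ ∞ F) (hFd : ∀ y, HasDerivAt F (F' y) y) (hF0 : F 0 = 0)
    (hF1 : ∀ y, |F' y| ≤ 1) (η : ℝ) :
    G.HasSobolevGradient p Ω (fun x => η * F (f x)) (fun x => (η * F' (f x)) • g x) := by
  obtain ⟨hfm, hgm, φ, hφ, hφ1, hφ2⟩ := h
  have : IsFiniteMeasure (volume.restrict Ω) :=
    ⟨by rw [Measure.restrict_apply_univ]; exact hΩ.lt_top⟩
  have hp0 : p ≠ 0 := (zero_lt_one.trans_le hp1).ne'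
  have hpt : p ≠ ⊤ := ne_top_of_le_ne_top hm hpm
  have hF'c : Continuous F' := by
    have := (contDiff_infty_iff_deriv.1 hF).2.continuous
    rwa [show deriv F = F' from funext fun y => (hFd y).deriv] at this
  have hLip : ∀ y z, |F y - F z| ≤ |y - z| := by
    intro y z
    have := Convex.norm_image_sub_le_of_norm_hasDerivWithin_le (f := F) (f' := F') (C := 1)
      (s := univ) (x := z) (y := y) (fun x _ => (hFd x).hasDerivWithinAt) (fun x _ => hF1 x)
      convex_univ (mem_univ _) (mem_univ _)
    simpa using this
  have hdown : ∀ {E : Type} [NormedAddCommGroup E] {w : ℕ → Strata N → E},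
      (∀ n, AEStronglyMeasurable (w n) (volume.restrict Ω)) →
      Tendsto (fun n => eLpNorm (w n) m (volume.restrict Ω)) atTop (𝓝 0) →
      Tendsto (fun n => eLpNorm (w n) p (volume.restrict Ω)) atTop (𝓝 0) := by
    intro E _ w hw hlim
    have hb : ∀ n, eLpNorm (w n) p (volume.restrict Ω) ≤
        eLpNorm (w n) m (volume.restrict Ω) *
          (volume.restrict Ω) univ ^ (1 / p.toReal - 1 / m.toReal) :=
      fun n => eLpNorm_le_eLpNorm_mul_rpow_measure_univ hpm (hw n)
    refine tendsto_of_tendsto_of_tendsto_of_le_of_le tendsto_const_nhds ?_ (fun _ => zero_le) hb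
    have hne : (volume.restrict Ω) univ ^ (1 / p.toReal - 1 / m.toReal) ≠ ⊤ := by
      refine ENNReal.rpow_ne_top_of_nonneg ?_ (measure_ne_top _ _)
      rw [sub_nonneg]
      exact one_div_le_one_div_of_le (ENNReal.toReal_pos hp0 hpt)
        (ENNReal.toReal_mono hm hpm)
    simpa using ENNReal.Tendsto.mul_const hlim (Or.inr hne)
  have hφm : ∀ n, AEStronglyMeasurable (φ n) (volume.restrict Ω) :=
    fun n => (hφ n).1.continuous.aestronglyMeasurable
  have hGm : ∀ n, AEStronglyMeasurable (G.horizontalGradient (φ n)) (volume.restrict Ω) :=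
    fun n => (G.measurable_horizontalGradient (hφ n).1).aestronglyMeasurable
  have hφ1p := hdown (fun n => hfm.1.sub (hφm n)) hφ1
  have hφ2p := hdown (fun n => hgm.1.sub (hGm n)) hφ2
  have hfp := hfm.mono_exponent hpm
  have hgp := hgm.mono_exponent hpm
  -- Norm convergence does not give pointwise convergence of `F'(φ_n)`; a subsequence converging
  -- almost everywhere does.
  obtain ⟨ns, hns, hae⟩ := (tendstoInMeasure_of_tendsto_eLpNorm hp0 hφm hfm.1 (by
    simp_rw [eLpNorm_sub_comm (φ _) f]
    exact hφ1p)).exists_seq_tendsto_ae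
  have hηe : ∀ {E : Type} [NormedAddCommGroup E] [NormedSpace ℝ E] (w : ℕ → Strata N → E),
      Tendsto (fun n => eLpNorm (w n) p (volume.restrict Ω)) atTop (𝓝 0) →
      Tendsto (fun n => eLpNorm (η • w n) p (volume.restrict Ω)) atTop (𝓝 0) := by
    intro E _ _ w hlim
    simp_rw [eLpNorm_const_smul]
    simpa using ENNReal.Tendsto.const_mul hlim (Or.inr (enorm_ne_top (x := η)))
  refine ⟨?_, ?_, fun n x => η * F (φ (ns n) x), ?_, ?_, ?_⟩
  · refine MemLp.const_mul (hfp.of_le (hF.continuous.comp_aestronglyMeasurable hfm.1)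
      (ae_of_all _ fun x => ?_)) η
    simpa [hF0] using hLip (f x) 0
  · have : MemLp (fun x => F' (f x) • g x) p (volume.restrict Ω) := by
      refine hgp.of_le ((hF'c.comp_aestronglyMeasurable hfm.1).smul hgm.1)
        (ae_of_all _ fun x => ?_)
      rw [norm_smul]
      exact mul_le_of_le_one_left (norm_nonneg _) (hF1 _)
    refine (this.const_smul η).congr_norm ?_ (ae_of_all _ fun x => ?_)
    · exact (((hF'c.comp_aestronglyMeasurable hfm.1).const_mul η).smul hgm.1)
    · simp [mul_smul]
  · intro n
    have hsub : tsupport (fun x => η * F (φ (ns n) x)) ⊆ tsupport (φ (ns n)) := by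
      refine closure_mono fun x hx => ?_
      intro h0
      exact hx (by simp [h0, hF0])
    exact ⟨contDiff_const.mul (hF.comp (hφ _).1),
      IsCompact.of_isClosed_subset (hφ (ns n)).2.1 (isClosed_tsupport _) hsub,
      hsub.trans (hφ (ns n)).2.2⟩
  · have h1 : Tendsto (fun n => eLpNorm (fun x => F (f x) - F (φ (ns n) x)) p
        (volume.restrict Ω)) atTop (𝓝 0) := by
      refine tendsto_of_tendsto_of_tendsto_of_le_of_le tendsto_const_nhds
        (hφ1p.comp hns.tendsto_atTop) (fun _ => zero_le) fun n => ?_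
      exact eLpNorm_mono fun x => hLip _ _
    refine (hηe _ h1).congr fun n => ?_
    congr 1
    ext x
    simp [mul_sub]
  · have hgrad : ∀ n, G.horizontalGradient (fun x => η * F (φ (ns n) x)) =
        fun x => (η * F' (φ (ns n) x)) • G.horizontalGradient (φ (ns n)) x := fun n =>
      G.horizontalGradient_comp (f := fun y => η * F y) (F' := fun y => η * F' y)
        (fun y => (hFd y).const_mul η) ((hφ (ns n)).1.differentiable (by simp)) rfl
    have h1 : Tendsto (fun n => eLpNorm (fun x => (F' (f x) - F' (φ (ns n) x)) • g x) p
        (volume.restrict Ω)) atTop (𝓝 0) := by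
      refine tendsto_eLpNorm_smul_zero_of_dominated hp0 hpt (C := 2) (fun n => ?_) (fun n x => ?_)
        hgp ?_
      · exact (hF'c.comp_aestronglyMeasurable hfm.1).sub
          (hF'c.comp_aestronglyMeasurable (hφm _))
      · exact (abs_sub _ _).trans (by linarith [hF1 (f x), hF1 (φ (ns n) x)])
      · filter_upwards [hae] with x hx
        have := ((hF'c.tendsto (f x)).comp hx).const_sub (F' (f x))
        simpa using this
    have h2 : Tendsto (fun n => eLpNorm (fun x => F' (φ (ns n) x) •
        (g x - G.horizontalGradient (φ (ns n)) x)) p (volume.restrict Ω)) atTop (𝓝 0) := by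
      refine tendsto_of_tendsto_of_tendsto_of_le_of_le tendsto_const_nhds
        (hφ2p.comp hns.tendsto_atTop) (fun _ => zero_le) fun n => ?_
      refine eLpNorm_mono fun x => ?_
      rw [norm_smul]
      exact mul_le_of_le_one_left (norm_nonneg _) (hF1 _)
    have h3 : Tendsto (fun n => eLpNorm (fun x => F' (f x) • g x -
        F' (φ (ns n) x) • G.horizontalGradient (φ (ns n)) x) p (volume.restrict Ω))
        atTop (𝓝 0) := by
      refine tendsto_of_tendsto_of_tendsto_of_le_of_le tendsto_const_nhds
        (by simpa using h1.add h2) (fun _ => zero_le) fun n => ?_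
      -- The first summand tends to zero by dominated convergence, the second because `|F'| ≤ 1`.
      have e : (fun x => F' (f x) • g x -
          F' (φ (ns n) x) • G.horizontalGradient (φ (ns n)) x) =
          (fun x => (F' (f x) - F' (φ (ns n) x)) • g x) +
          (fun x => F' (φ (ns n) x) • (g x - G.horizontalGradient (φ (ns n)) x)) := by
        ext1 x
        simp only [Pi.add_apply, sub_smul, smul_sub]
        abel
      rw [e]
      exact eLpNorm_add_le
        (((hF'c.comp_aestronglyMeasurable hfm.1).sub
          (hF'c.comp_aestronglyMeasurable (hφm _))).smul hgm.1)
        ((hF'c.comp_aestronglyMeasurable (hφm _)).smul (hgm.1.sub (hGm _))) hp1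
    refine (hηe _ h3).congr fun n => ?_
    congr 1
    rw [hgrad]
    ext1 x
    simp [smul_sub, mul_smul]

end StratifiedGroup

/-! ### The smooth truncation and the sign of the source. -/

/-- Vanishing below `M` and positivity above it pass to the primitive. This is applied twice, from
the smooth transition to `F` and from `F` to `Φ`. -/
theorem primitive_properties {f : ℝ → ℝ} (hf : Continuous f) {M : ℝ} (h0 : ∀ y ≤ M, f y = 0)
    (hpos : ∀ y, M < y → 0 < f y) :
    (∀ y, HasDerivAt (fun y => ∫ s in M..y, f s) (f y) y) ∧
      (∀ y ≤ M, ∫ s in M..y, f s = 0) ∧ ∀ y, M < y → 0 < ∫ s in M..y, f s := by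
  refine ⟨fun y => (hf.integral_hasStrictDerivAt M y).hasDerivAt, fun y hy => ?_, fun y hy => ?_⟩
  · rw [intervalIntegral.integral_congr (g := fun _ => 0) fun s hs => ?_]
    · simp
    · rw [uIcc_of_ge hy] at hs
      exact h0 s hs.2
  · exact intervalIntegral.intervalIntegral_pos_of_pos_on (hf.intervalIntegrable _ _)
      (fun s hs => hpos s hs.1) hy

/-- A smooth substitute `F` for `y ↦ (y - M)₊`, with derivative `F'` and primitive `Φ`. -/
theorem exists_smooth_truncation (M : ℝ) :
    ∃ F F' Φ : ℝ → ℝ, ContDiff ℝ ∞ F ∧ (∀ y, HasDerivAt F (F' y) y) ∧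
      (∀ y, HasDerivAt Φ (F y) y) ∧ (∀ y, 0 ≤ F' y ∧ F' y ≤ 1) ∧ (∀ y ≤ M, F y = 0) ∧
      (∀ y, 0 ≤ F y) ∧ (∀ y ≤ M, Φ y = 0) ∧ ∀ y, M < y → 0 < Φ y := by
  have hS : ContDiff ℝ ∞ fun y => Real.smoothTransition (y - M) :=
    Real.smoothTransition.contDiff.comp (contDiff_id.sub contDiff_const)
  obtain ⟨a1, a2, a3⟩ := primitive_properties hS.continuous (M := M)
    (fun y hy => Real.smoothTransition.zero_of_nonpos (by linarith))
    (fun y hy => Real.smoothTransition.pos_of_pos (by linarith))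
  have hF : ContDiff ℝ ∞ fun y => ∫ s in M..y, Real.smoothTransition (s - M) := by
    rw [contDiff_infty_iff_deriv]
    refine ⟨fun y => (a1 y).differentiableAt, ?_⟩
    rwa [show deriv _ = _ from funext fun y => (a1 y).deriv]
  obtain ⟨b1, b2, b3⟩ := primitive_properties hF.continuous a2 a3
  refine ⟨_, _, _, hF, a1, b1, fun y => ⟨Real.smoothTransition.nonneg _,
    Real.smoothTransition.le_one _⟩, a2, fun y => ?_, b2, b3⟩
  rcases le_or_gt y M with h | h
  · exact (a2 y h).ge
  · exact (a3 y h).le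

/-- For `y > 0` the factor `y ^ q` splits off and leaves `a + c y ^ (s - q)`, which is nonpositive
once `y ^ (s - q) ≥ a / (-c)`. -/
theorem eventually_mul_rpow_add_mul_rpow_nonpos (a : ℝ) {c q s : ℝ} (hc : c < 0) (hqs : q < s) :
    ∀ᶠ y : ℝ in atTop, a * (|y| ^ (q - 1) * y) + c * (|y| ^ (s - 1) * y) ≤ 0 := by
  have h := (tendsto_rpow_atTop (sub_pos.2 hqs)).eventually_ge_atTop (a / -c)
  filter_upwards [h, eventually_gt_atTop 0] with y hy hy0
  have e : |y| ^ (s - 1) = |y| ^ (q - 1) * y ^ (s - q) := by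
    rw [abs_of_pos hy0, ← Real.rpow_add hy0]
    ring_nf
  have h1 : a ≤ y ^ (s - q) * -c := by rwa [div_le_iff₀ (by linarith)] at hy
  have h2 : 0 ≤ |y| ^ (q - 1) * y := by positivity
  rw [e]
  nlinarith

namespace HeatData

variable {k : ℕ} {N : Fin (k + 1) → ℕ} {D : HeatData N}

theorem source_eq_sum (y : ℝ) :
    D.source y = ∑ i, (D.α * (|y| ^ (D.q i - 1) * y) + D.γ * (|y| ^ (D.s i - 1) * y)) := by
  rw [source, Finset.sum_add_distrib, Finset.mul_sum, Finset.mul_sum]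

/-- The powers are compared in pairs with equal index; as there are finitely many, one threshold
serves all pairs. -/
theorem eventually_source_nonpos
    (h : (D.γ < 0 ∧ ∀ i, D.q i < D.s i) ∨ (D.α < 0 ∧ ∀ i, D.s i < D.q i)) :
    ∀ᶠ y in atTop, D.source y ≤ 0 := by
  have h' : ∀ᶠ y : ℝ in atTop, ∀ i,
      D.α * (|y| ^ (D.q i - 1) * y) + D.γ * (|y| ^ (D.s i - 1) * y) ≤ 0 := by
    rw [eventually_all]
    intro i
    rcases h with ⟨h1, h2⟩ | ⟨h1, h2⟩
    · exact eventually_mul_rpow_add_mul_rpow_nonpos _ h1 (h2 i)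
    · simp_rw [add_comm (D.α * _)]
      exact eventually_mul_rpow_add_mul_rpow_nonpos _ h1 (h2 i)
  filter_upwards [h'] with y hy
  rw [source_eq_sum]
  exact Finset.sum_nonpos fun i _ => hy i

/-! ### The weak maximum principle. -/

/-- Weak maximum principle: a level `M ≥ 0` above which the source is nonpositive and which bounds
the initial datum bounds every weak sub-solution. -/
theorem IsWeakSubsolution.le_of_source_nonpos {G : StratifiedGroup N} {Ω : Set (Strata N)}
    (hΩ : IsOpen Ω) (hΩb : Bornology.IsBounded Ω) (hp : 1 < D.p) {M : ℝ} (hM : 0 ≤ M)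
    (hsource : ∀ y, M ≤ y → D.source y ≤ 0)
    (hu₀ : ∀ᵐ x ∂(volume.restrict Ω), D.u₀ x ≤ M) {T : ℝ}
    {u : ℝ → Strata N → ℝ} (hu : D.IsWeakSubsolution G Ω T u) :
    ∀ t ∈ Ioo 0 T, ∀ x ∈ Ω, u t x ≤ M := by
  obtain ⟨-, hcont, hini, hbd, ut, g, ⟨hutL2, hutd⟩, ⟨hum, hgm, hsob⟩, htest⟩ := hu
  obtain ⟨F, F', Φ, hF, hFd, hΦd, hF', hF0, hFnn, hΦ0, hΦpos⟩ := exists_smooth_truncation M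
  intro t₀ ht₀
  have hT : 0 < T := ht₀.1.trans ht₀.2
  -- Any `b` strictly between `t₀` and `T` serves. The weight then vanishes near `T`, so the test
  -- function is continuous on the closed cylinder although `u` need not extend to `t = T`.
  set b := (t₀ + T) / 2 with hb
  have hb0 : 0 < b := by linarith [ht₀.1]
  have hbT : b < T := by linarith [ht₀.2]
  have htb : t₀ ≤ b := by linarith [ht₀.2]
  have hprod : (volume : Measure (ℝ × Strata N)).restrict (Ioo 0 T ×ˢ Ω) =
      (volume.restrict (Ioo 0 T)).prod (volume.restrict Ω) := by
    rw [Measure.prod_restrict, Measure.volume_eq_prod]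
  have hmeas : MeasurableSet (Ioo 0 T ×ˢ Ω) := measurableSet_Ioo.prod hΩ.measurableSet
  have hcpt : IsCompact (closure (Ioo 0 T ×ˢ Ω)) :=
    ((Metric.isBounded_Ioo 0 T).prod hΩb).isCompact_closure
  have : IsFiniteMeasure ((volume : Measure (ℝ × Strata N)).restrict (Ioo 0 T ×ˢ Ω)) :=
    ⟨by
      rw [Measure.restrict_apply_univ]
      exact (measure_mono subset_closure).trans_lt hcpt.measure_lt_top⟩
  have hp1 : (1 : ℝ≥0∞) ≤ ENNReal.ofReal D.p := by
    rw [ENNReal.one_le_ofReal]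
    exact hp.le
  have hpm : ENNReal.ofReal D.p ≤ ENNReal.ofReal D.m :=
    ENNReal.ofReal_le_ofReal (le_max_left _ _)
  have hFc : Continuous F := hF.continuous
  have hF'c : Continuous F' := by
    have := (contDiff_infty_iff_deriv.1 hF).2.continuous
    rwa [show deriv F = F' from funext fun y => (hFd y).deriv] at this
  have hΦc : Continuous Φ := continuous_iff_continuousAt.2 fun y => (hΦd y).continuousAt
  have hΦnn : ∀ y, 0 ≤ Φ y := fun y => by
    rcases le_or_gt y M with h | h
    · exact (hΦ0 y h).ge
    · exact (hΦpos y h).le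
  have hF'1 : ∀ y, |F' y| ≤ 1 := fun y => by
    rw [abs_of_nonneg (hF' y).1]
    exact (hF' y).2
  have hFle : ∀ y, |F y| ≤ |y| := by
    intro y
    have := Convex.norm_image_sub_le_of_norm_hasDerivWithin_le (f := F) (f' := F') (C := 1)
      (s := univ) (x := 0) (y := y) (fun x _ => (hFd x).hasDerivWithinAt) (fun x _ => hF'1 x)
      convex_univ (mem_univ _) (mem_univ _)
    simpa [hF0 0 hM] using this
  set η : ℝ → ℝ := fun t => max (b - t) 0 with hη
  have hηc : Continuous η := by fun_prop
  have hηnn : ∀ t, 0 ≤ η t := fun t => le_max_right _ _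
  have hηT : ∀ t ∈ Ioo 0 T, η t ≤ T := fun t ht => max_le (by linarith [ht.1]) hT.le
  have hφc : ContinuousOn (fun z : ℝ × Strata N => η z.1 * F (u z.1 z.2))
      (closure (Ioo 0 T ×ˢ Ω)) := by
    rw [closure_prod_eq, closure_Ioo hT.ne]
    rintro ⟨t, x⟩ ⟨ht, hx⟩
    rcases lt_or_ge t T with h | h
    · have h1 : ContinuousWithinAt (fun z : ℝ × Strata N => η z.1 * F (u z.1 z.2))
          (Ico 0 T ×ˢ closure Ω) (t, x) :=
        (hηc.comp continuous_fst).continuousWithinAt.mul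
          (hFc.continuousAt.comp_continuousWithinAt (hcont (t, x) ⟨⟨ht.1, h⟩, hx⟩))
      refine h1.mono_of_mem_nhdsWithin ?_
      have h2 : {z : ℝ × Strata N | z.1 < T} ∈ 𝓝 (t, x) :=
        (isOpen_lt continuous_fst continuous_const).mem_nhds h
      filter_upwards [self_mem_nhdsWithin, mem_nhdsWithin_of_mem_nhds h2] with z hz1 hz2
      exact ⟨⟨hz1.1.1, hz2⟩, hz1.2⟩
    · have h1 : (fun z : ℝ × Strata N => η z.1 * F (u z.1 z.2)) =ᶠ[𝓝 (t, x)] fun _ => 0 := by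
        have h2 : {z : ℝ × Strata N | b < z.1} ∈ 𝓝 (t, x) :=
          (isOpen_lt continuous_const continuous_fst).mem_nhds (hbT.trans_le h)
        filter_upwards [h2] with z hz
        have : η z.1 = 0 := max_eq_right (by linarith [show b < z.1 from hz])
        rw [this, zero_mul]
      exact (continuousAt_const.congr h1.symm).continuousWithinAt
  have hηm : AEStronglyMeasurable (fun z : ℝ × Strata N => η z.1)
      (volume.restrict (Ioo 0 T ×ˢ Ω)) := (hηc.comp continuous_fst).aestronglyMeasurable
  have hFm : AEStronglyMeasurable (fun z : ℝ × Strata N => F (u z.1 z.2))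
      (volume.restrict (Ioo 0 T ×ˢ Ω)) := hFc.comp_aestronglyMeasurable hum.1
  have hF'm : AEStronglyMeasurable (fun z : ℝ × Strata N => F' (u z.1 z.2))
      (volume.restrict (Ioo 0 T ×ˢ Ω)) := hF'c.comp_aestronglyMeasurable hum.1
  have hup := hum.mono_exponent hpm
  have hgp := hgm.mono_exponent hpm
  have hpar : G.HasParabolicGradient (ENNReal.ofReal D.p) T Ω (fun t x => η t * F (u t x))
      (fun t x => (η t * F' (u t x)) • g t x) := by
    refine ⟨?_, ?_, ?_⟩
    · refine (hup.const_mul T).of_le (hηm.mul hFm) ?_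
      filter_upwards [ae_restrict_mem hmeas] with z hz
      rw [norm_mul, norm_mul, Real.norm_of_nonneg (hηnn _), Real.norm_of_nonneg hT.le]
      exact mul_le_mul (hηT _ hz.1) (hFle _) (norm_nonneg _) hT.le
    · refine (hgp.const_smul T).of_le ((hηm.mul hF'm).smul hgp.1) ?_
      filter_upwards [ae_restrict_mem hmeas] with z hz
      simp only [Pi.smul_apply]
      rw [norm_smul, norm_smul, norm_mul, Real.norm_of_nonneg (hηnn _),
        Real.norm_of_nonneg hT.le]
      refine mul_le_mul_of_nonneg_right ?_ (norm_nonneg _)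
      simpa using mul_le_mul (hηT _ hz.1) (hF'1 (u z.1 z.2)) (abs_nonneg _) hT.le
    · filter_upwards [hsob] with t ht
      exact ht.comp G hp1 hpm ENNReal.ofReal_ne_top hΩb.measure_lt_top.ne hF hFd (hF0 0 hM)
        hF'1 (η t)
  -- On the lateral boundary `u ≤ 0 ≤ M`, so `F(u)` vanishes there.
  have hmain := htest (fun t x => η t * F (u t x)) (fun t x => (η t * F' (u t x)) • g t x) hφc
    hpar (fun t _ x _ => mul_nonneg (hηnn t) (hFnn _)) (fun t ht x hx => by
      rw [hF0 _ ((hbd t ht x hx).trans hM), mul_zero])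
  simp only at hmain
  have hrhs : ∫ z in Ioo 0 T ×ˢ Ω, D.source (u z.1 z.2) * (η z.1 * F (u z.1 z.2)) ≤ 0 := by
    refine integral_nonpos fun z => ?_
    rcases le_or_gt (u z.1 z.2) M with h | h
    · simp [hF0 _ h]
    · exact mul_nonpos_of_nonpos_of_nonneg (hsource _ h.le) (mul_nonneg (hηnn _) (hFnn _))
  have hutI : IntegrableOn (fun z : ℝ × Strata N => ut z.1 z.2) (Ioo 0 T ×ˢ Ω) :=
    hutL2.integrable (by norm_num)
  have huI : IntegrableOn (fun z : ℝ × Strata N => u z.1 z.2) (Ioo 0 T ×ˢ Ω) :=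
    hup.integrable hp1
  have hI1 : IntegrableOn (fun z : ℝ × Strata N => ut z.1 z.2 * (η z.1 * F (u z.1 z.2)))
      (Ioo 0 T ×ˢ Ω) := by
    obtain ⟨C, hC⟩ := hcpt.exists_bound_of_continuousOn hφc
    refine Integrable.mul_bdd (c := C) hutI (hηm.mul hFm) ?_
    filter_upwards [ae_restrict_mem hmeas] with z hz using hC z (subset_closure hz)
  have hrew : ∀ z : ℝ × Strata N, ‖g z.1 z.2‖ ^ (D.p - 2) *
      inner ℝ (g z.1 z.2) ((η z.1 * F' (u z.1 z.2)) • g z.1 z.2) =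
      (η z.1 * F' (u z.1 z.2)) * ‖g z.1 z.2‖ ^ D.p := by
    intro z
    rw [inner_smul_right, real_inner_self_eq_norm_sq]
    -- For `p < 2` the factor `‖g‖ ^ (p - 2)` is singular at `g = 0`; its value there is immaterial,
    -- because the inner product is zero.
    rcases (norm_nonneg (g z.1 z.2)).eq_or_lt with h | h
    · rw [← h, Real.zero_rpow (by linarith : D.p ≠ 0)]
      simp
    · rw [show D.p = (D.p - 2) + (2 : ℕ) by push_cast; ring, Real.rpow_add h, Real.rpow_natCast]
      push_cast
      ring_nf
  have hI2 : IntegrableOn (fun z : ℝ × Strata N => (η z.1 * F' (u z.1 z.2)) *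
      ‖g z.1 z.2‖ ^ D.p) (Ioo 0 T ×ˢ Ω) := by
    have h1 := hgp.integrable_norm_rpow (zero_lt_one.trans_le hp1).ne' ENNReal.ofReal_ne_top
    rw [ENNReal.toReal_ofReal (by linarith)] at h1
    refine Integrable.bdd_mul (c := T) h1 (hηm.mul hF'm) ?_
    filter_upwards [ae_restrict_mem hmeas] with z hz
    rw [norm_mul, Real.norm_of_nonneg (hηnn _)]
    simpa using mul_le_mul (hηT _ hz.1) (hF'1 (u z.1 z.2)) (abs_nonneg _) hT.le
  simp_rw [hrew] at hmain
  rw [integral_add hI1 hI2] at hmain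
  have hI2nn : 0 ≤ ∫ z in Ioo 0 T ×ˢ Ω, (η z.1 * F' (u z.1 z.2)) * ‖g z.1 z.2‖ ^ D.p :=
    integral_nonneg fun z => mul_nonneg (mul_nonneg (hηnn _) (hF' _).1)
      (Real.rpow_nonneg (norm_nonneg _) _)
  have hut : ∫ z in Ioo 0 T ×ˢ Ω, ut z.1 z.2 * (η z.1 * F (u z.1 z.2)) ≤ 0 := by linarith
  rw [IntegrableOn, hprod] at hI1
  rw [hprod, integral_prod_symm _ hI1] at hut
  have hux : ∀ x ∈ Ω, ContinuousOn (fun t => u t x) (Ico 0 T) := fun x hx =>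
    hcont.comp (f := fun t => (t, x)) (by fun_prop) fun t ht => ⟨ht, subset_closure hx⟩
  have hJ : (fun x => ∫ t in Ioo 0 T, ut t x * (η t * F (u t x))) =ᵐ[volume.restrict Ω]
      fun x => ∫ t in (0 : ℝ)..b, Φ (u t x) := by
    filter_upwards [ae_forall_eq_add_primitive hT hΩ
      (hcont.mono (prod_mono le_rfl subset_closure)) huI hutI hutd, hini, hu₀] with x hx h1 h2
    have hsub : Ioc 0 b ⊆ Ioo 0 T := fun t ht => ⟨ht.1, ht.2.trans_lt hbT⟩
    have hvi : IntervalIntegrable (fun t => ut t x) volume 0 b :=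
      (intervalIntegrable_iff_integrableOn_Ioc_of_le hb0.le).2 (hx.1.mono_set hsub)
    have ibp := integral_sub_mul_deriv_comp hvi hFc hΦd (hΦ0 _ (h1.trans h2))
    have e0 : ∫ t in Ioo 0 T, ut t x * (η t * F (u t x)) =
        ∫ t in Ioc 0 b, ut t x * (η t * F (u t x)) := by
      refine (setIntegral_eq_of_subset_of_forall_sdiff_eq_zero measurableSet_Ioo hsub ?_)
      rintro t ⟨ht1, ht2⟩
      have : η t = 0 := max_eq_right (by
        by_contra h
        exact ht2 ⟨ht1.1, by linarith⟩)
      rw [this, zero_mul, mul_zero]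
    rw [e0, ← intervalIntegral.integral_of_le hb0.le]
    have hIcc : ∀ t ∈ uIcc 0 b, u t x = u 0 x + ∫ s in (0 : ℝ)..t, ut s x := by
      intro t ht
      rw [uIcc_of_le hb0.le] at ht
      exact hx.2 t ⟨ht.1, ht.2.trans_lt hbT⟩
    have e1 : ∫ t in (0 : ℝ)..b, ut t x * (η t * F (u t x)) =
        ∫ t in (0 : ℝ)..b, ut t x * ((b - t) * F (u 0 x + ∫ s in (0 : ℝ)..t, ut s x)) := by
      refine intervalIntegral.integral_congr fun t ht => ?_
      have h3 := hIcc t ht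
      rw [uIcc_of_le hb0.le] at ht
      have : η t = b - t := max_eq_left (by linarith [ht.2])
      simp only [this, h3]
    rw [e1, ibp]
    refine intervalIntegral.integral_congr fun t ht => ?_
    simp only [hIcc t ht]
  have hJi : Integrable (fun x => ∫ t in (0 : ℝ)..b, Φ (u t x)) (volume.restrict Ω) :=
    hI1.integral_prod_right.congr hJ
  have hJnn : ∀ x, 0 ≤ ∫ t in (0 : ℝ)..b, Φ (u t x) := fun x =>
    intervalIntegral.integral_nonneg hb0.le fun t _ => hΦnn _
  rw [integral_congr_ae hJ] at hut
  -- A nonnegative function with nonpositive integral vanishes almost everywhere.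
  have hJ0 := (integral_eq_zero_iff_of_nonneg hJnn hJi).1 (hut.antisymm (integral_nonneg hJnn))
  have hΦu : ContinuousOn (fun x => Φ (u t₀ x)) Ω :=
    hΦc.comp_continuousOn (hcont.comp (f := fun x => (t₀, x)) (by fun_prop)
      fun x hx => ⟨Ioo_subset_Ico_self ht₀, subset_closure hx⟩)
  have hz : (fun x => Φ (u t₀ x)) =ᵐ[volume.restrict Ω] fun _ => 0 := by
    filter_upwards [hJ0, ae_restrict_mem hΩ.measurableSet] with x hx hxΩ
    by_contra hne
    -- A positive value at `t₀` would persist nearby, by continuity in time, and make the integral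
    -- over `[0,b]` positive.
    have hpos := intervalIntegral.integral_pos hb0 (f := fun t => Φ (u t x))
      (hΦc.comp_continuousOn ((hux x hxΩ).mono fun t ht => ⟨ht.1, ht.2.trans_lt hbT⟩))
      (fun t _ => hΦnn _) ⟨t₀, ⟨ht₀.1.le, htb⟩, lt_of_le_of_ne (hΦnn _) (Ne.symm hne)⟩
    exact hpos.ne' hx
  intro x hx
  by_contra h
  -- Continuity in space on the open set `Ω` removes the exceptional null set.
  have := Measure.eqOn_open_of_ae_eq hz hΩ hΦu continuousOn_const hx
  exact (hΦpos _ (not_le.1 h)).ne' this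

end HeatData

/-! ### The global bound. -/

theorem mainTheorem5 {k : ℕ} {N : Fin (k + 1) → ℕ} (D : HeatData N) (hn : 0 < D.n)
    (Ω : Set (Strata N)) (hΩ_open : IsOpen Ω) (hΩ_bdd : Bornology.IsBounded Ω)
    (hparam :
      (0 < D.α ∧ D.γ < 0 ∧ (∀ i, 1 ≤ D.q i) ∧ 1 < D.p ∧ D.p < (⨅ i, D.s i) + 1 ∧
        ∀ i, D.q i < D.s i) ∨
      (D.α < 0 ∧ 0 < D.γ ∧ (∀ i, 1 ≤ D.s i) ∧ 1 < D.p ∧ D.p < (⨅ i, D.q i) + 1 ∧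
        ∀ i, D.s i < D.q i))
    (hu₀_nonneg : ∀ᵐ x ∂(volume.restrict Ω), 0 ≤ D.u₀ x)
    (hu₀_ne : ¬ D.u₀ =ᵐ[volume.restrict Ω] 0) :
    ∃ M : ℝ, ∀ G : StratifiedGroup N, G.MemSobolev ⊤ Ω D.u₀ →
      ∀ T : ℝ, 0 < T → ∀ u : ℝ → Strata N → ℝ, D.IsWeakSolution G Ω T u →
        ∀ t ∈ Ioo 0 T, ∀ x ∈ Ω, 0 ≤ u t x ∧ u t x ≤ M := by
  have hp : 1 < D.p := by
    rcases hparam with h | h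
    · exact h.2.2.2.1
    · exact h.2.2.2.1
  obtain ⟨M₀, hM₀⟩ := eventually_atTop.1 (D.eventually_source_nonpos (by
    rcases hparam with h | h
    · exact Or.inl ⟨h.2.1, h.2.2.2.2.2⟩
    · exact Or.inr ⟨h.1, h.2.2.2.2.2⟩))
  -- The bound is chosen before the group. An infinite essential supremum would be sent to `0` by
  -- `toReal`, but membership of `u₀` in `S₀^{1,∞}(Ω)` excludes that case.
  refine ⟨max (max M₀ 0) (eLpNormEssSup D.u₀ (volume.restrict Ω)).toReal, ?_⟩
  rintro G ⟨_, hu₀, -⟩ T - u ⟨hsuper, hsub⟩ t ht x hx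
  refine ⟨hsuper.1 t (Ioo_subset_Ico_self ht) x (subset_closure hx), ?_⟩
  refine hsub.le_of_source_nonpos hΩ_open hΩ_bdd hp
    ((le_max_right _ _).trans (le_max_left _ _))
    (fun y hy => hM₀ y (((le_max_left _ _).trans (le_max_left _ _)).trans hy)) ?_ t ht x hx
  have hfin : eLpNormEssSup D.u₀ (volume.restrict Ω) ≠ ⊤ := by
    rw [← eLpNorm_exponent_top]
    exact hu₀.2.ne
  filter_upwards [enorm_ae_le_eLpNormEssSup D.u₀ (volume.restrict Ω)] with x hx
  refine ((le_abs_self _).trans ?_).trans (le_max_right _ _)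
  have := ENNReal.toReal_mono hfin hx
  simpa using this
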